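/- Let $H(\mathbb{C})$ be the space of entire functions with the topology of uniform convergence on compact sets, and let $D$ be the differentiation operator on it. Let $(P_n)_{n\ge 1}$ be a sequence of nonconstant complex polynomials, $P_n(z)=\sum_{j=m(n)}^{d(n)}c_{j,n}z^j$ with $c_{m(n),n}\neq 0\neq c_{d(n),n}$ (so that $m(n)$, the valence of $P_n$, is its order of vanishing at $0$), and put $c_{j,n}=0$ for $j>d(n)$. Call a set $U\subset\mathbb{C}$ an $\mathcal{E}$-unicity set if the only entire function $f$ of exponential type (that is, with $|f(z)|\le Ae^{B|z|}$ for all $z\in\mathbb{C}$ and some constants $A,B>0$) that vanishes on $U$ is $f\equiv 0$. Suppose that the sequence $(m(n))$ is unbounded and that at least one of the following holds: - (P) there is an $\mathcal{E}$-unicity set $U\subset\mathbb{C}$ such that $\lim_{n\to\infty}|P_n(z)|=+\infty$ for every $z\in U$; - (Q) for every integer $k\ge 1$, $\lim_{n\to\infty}m(n)\,|c_{m(n),n}|^{k/m(n)}=+\infty$ (in particular $m(n)\ge 1$ for all large $n$) and the sequence $(c_{k+m(n),n})_{n\ge 1}$ is bounded; - (R) there is $r>0$ such that $\lim_{n\to\infty}\min\{|P_n(z)|:|z|=r\}=+\infty$.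 For $f\in H(\mathbb{C})$ let $P_n(D)f=\sum_{j=m(n)}^{d(n)}c_{j,n}f^{(j)}$, and let $HC((P_n(D)))$ be the set of all $f\in H(\mathbb{C})$ whose orbit $\{P_n(D)f:n\ge 1\}$ is dense in $H(\mathbb{C})$. Then $HC((P_n(D)))$ is spaceable: there is a closed infinite-dimensional vector subspace $M\subset H(\mathbb{C})$ with $M\subset HC((P_n(D)))\cup\{0\}$. -/

import Mathlib

open Filter Topology Polynomial

namespace Hypercyclicity

section General

variable {X Y : Type*} [AddCommGroup X] [Module ℂ X] [TopologicalSpace X]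
  [AddCommGroup Y] [Module ℂ Y] [TopologicalSpace Y]

/-- `HC((T_n))`: the vectors whose orbit `{T_n x : n}` is dense in the target space. -/
def HC (T : ℕ → X →L[ℂ] Y) : Set X :=
  {x | Dense (Set.range fun n => T n x)}

/-- A subset of a topological vector space is spaceable if, together with `0`, it contains a
closed infinite-dimensional vector subspace. -/
def Spaceable (A : Set X) : Prop :=
  ∃ M : Submodule ℂ X, IsClosed (M : Set X) ∧ ¬ FiniteDimensional ℂ M ∧ (M : Set X) ⊆ A ∪ {0}

end General

/-- The entire functions, as a subspace of the space `C(ℂ, ℂ)` of continuous functions. -/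
def entireSubmodule : Submodule ℂ C(ℂ, ℂ) where
  carrier := {f | Differentiable ℂ f}
  add_mem' := fun hf hg => Differentiable.add hf hg
  zero_mem' := differentiable_const (0 : ℂ)
  smul_mem' := fun c _ hf => Differentiable.const_smul hf c

/-- The space `H(ℂ)` of entire functions. Its topology is the one induced by the compact-open
topology of `C(ℂ, ℂ)`, that is, the topology of uniform convergence on compact sets. -/
def EntireSpace : Type := entireSubmodule

namespace EntireSpace

noncomputable instance : AddCommGroup EntireSpace := inferInstanceAs (AddCommGroup entireSubmodule)

noncomputable instance : Module ℂ EntireSpace := inferInstanceAs (Module ℂ entireSubmodule)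

instance : TopologicalSpace EntireSpace := inferInstanceAs (TopologicalSpace entireSubmodule)

instance : IsTopologicalAddGroup EntireSpace :=
  inferInstanceAs (IsTopologicalAddGroup entireSubmodule)

instance : ContinuousSMul ℂ EntireSpace := inferInstanceAs (ContinuousSMul ℂ entireSubmodule)

noncomputable instance : FunLike EntireSpace ℂ ℂ where
  coe f := f.1
  coe_injective := fun _ _ h => Subtype.ext (DFunLike.coe_injective h)

theorem differentiable (f : EntireSpace) : Differentiable ℂ f := f.2

end EntireSpace

/-- The derivative of an entire function, as an entire function. -/
noncomputable def derivFun (f : EntireSpace) : EntireSpace :=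
  ⟨⟨deriv f, (Differentiable.deriv f.2).continuous⟩, Differentiable.deriv f.2⟩

theorem continuous_derivFun : Continuous derivFun := by
  rw [continuous_iff_continuousAt]
  intro f
  refine tendsto_subtype_rng.2 ?_
  rw [ContinuousMap.tendsto_iff_tendstoLocallyUniformly]
  have h : Tendsto (fun g : EntireSpace => (g.1 : C(ℂ, ℂ))) (𝓝 f) (𝓝 (f.1 : C(ℂ, ℂ))) :=
    continuous_subtype_val.tendsto f
  rw [ContinuousMap.tendsto_iff_tendstoLocallyUniformly, ← tendstoLocallyUniformlyOn_univ] at h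
  rw [← tendstoLocallyUniformlyOn_univ]
  exact h.deriv (Eventually.of_forall fun g => g.2.differentiableOn) isOpen_univ

/-- The differentiation operator `D` on `H(ℂ)`. -/
noncomputable def D : EntireSpace →L[ℂ] EntireSpace where
  toFun := derivFun
  map_add' := fun f g => DFunLike.ext _ _ fun z => deriv_add (f.2 z) (g.2 z)
  map_smul' := fun c f => DFunLike.ext _ _ fun z => deriv_const_smul c (f.2 z)
  cont := continuous_derivFun

/-- The differential operator `P(D) = ∑ c_j D^j` on `H(ℂ)`, for a polynomial `P = ∑ c_j z^j`. -/
noncomputable def diffOp (P : ℂ[X]) : EntireSpace →L[ℂ] EntireSpace :=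
  aeval D P

theorem D_pow_apply (j : ℕ) (f : EntireSpace) (z : ℂ) :
    (D ^ j) f z = iteratedDeriv j f z := by
  induction j generalizing z with
  | zero => simp
  | succ j ih =>
    rw [pow_succ', iteratedDeriv_succ]
    have : ((D ^ j) f : ℂ → ℂ) = iteratedDeriv j f := funext ih
    rw [← this]
    rfl

/-- `(P(D) f)(z) = ∑ c_j f^{(j)}(z)`. -/
theorem diffOp_apply (P : ℂ[X]) (f : EntireSpace) (z : ℂ) :
    diffOp P f z
      = ∑ j ∈ Finset.range (P.natDegree + 1), P.coeff j * iteratedDeriv j f z := by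
  have h : ∀ s : Finset ℕ, (∑ j ∈ s, P.coeff j • D ^ j) f z
      = ∑ j ∈ s, P.coeff j * iteratedDeriv j f z := by
    intro s
    induction s using Finset.induction_on with
    | empty => simp only [Finset.sum_empty]; rfl
    | insert a s ha ih =>
      rw [Finset.sum_insert ha, Finset.sum_insert ha, ← ih, ← D_pow_apply]
      rfl
  rw [diffOp, aeval_eq_sum_range, h]

/-- An entire function of exponential type: `|f(z)| ≤ A e^{B|z|}` for some `A, B > 0`. -/
def ExponentialType (f : EntireSpace) : Prop :=
  ∃ A B : ℝ, 0 < A ∧ 0 < B ∧ ∀ z : ℂ, ‖f z‖ ≤ A * Real.exp (B * ‖z‖)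

/-- A unicity set for the class of entire functions of exponential type. -/
def UnicitySet (U : Set ℂ) : Prop :=
  ∀ f : EntireSpace, ExponentialType f → (∀ z ∈ U, f z = 0) → f = 0

/-- The valence of a nonzero polynomial: its order of vanishing at the origin, that is, the
least `m` whose coefficient is nonzero. -/
noncomputable def valence (P : ℂ[X]) : ℕ := P.natTrailingDegree

/-- Property (P): `|P_n| → ∞` pointwise on some unicity set. -/
def PropertyP (P : ℕ → ℂ[X]) : Prop :=
  ∃ U : Set ℂ, UnicitySet U ∧ ∀ z ∈ U, Tendsto (fun n => ‖(P n).eval z‖) atTop atTop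

/-- Property (Q): for every `k ≥ 1`, with `m(n)` the valence and `c_{j,n}` the coefficients of
`P_n`, one has `m(n) |c_{m(n),n}|^{k/m(n)} → ∞`, and `(c_{k+m(n),n})_n` is bounded. (The limit
forces `m(n) ≥ 1` for all large `n`, so the value of the expression at `m(n) = 0` is
irrelevant.) -/
def PropertyQ (P : ℕ → ℂ[X]) : Prop :=
  ∀ k : ℕ, 1 ≤ k →
    Tendsto (fun n => (valence (P n) : ℝ) *
      ‖(P n).coeff (valence (P n))‖ ^ ((k : ℝ) / (valence (P n) : ℝ))) atTop atTop ∧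
    ∃ C : ℝ, ∀ n, ‖(P n).coeff (k + valence (P n))‖ ≤ C

/-- Property (R): for some `r > 0`, `min {|P_n(z)| : |z| = r} → ∞`. (The infimum is over a
nonempty compact set, so it is a minimum.) -/
def PropertyR (P : ℕ → ℂ[X]) : Prop :=
  ∃ r : ℝ, 0 < r ∧
    Tendsto (fun n => sInf ((fun z : ℂ => ‖(P n).eval z‖) '' Metric.sphere 0 r)) atTop atTop

end Hypercyclicity

/-!
The subspace is built from power series with blocks of coefficients. Choose degrees
`0 = j 0 < j 1 < …`, indices `n N` and polynomials `u N` supported strictly between `j N` and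
`j (N + 1)`, and let `M` be the space of the entire functions `h` whose coefficients at the degrees
`j k` are free and whose coefficients inside block `N` are those of `a • u N`, where `a` is the
coefficient of `h` at a free degree `j (i N)` attached to the block (`blockSubspace`). This space is
closed because Taylor coefficients are continuous. It is infinite-dimensional because, the
coefficients of `u N` being tiny, each free degree `j k` has an entire function in `M` whose
coefficient there is `1` and whose coefficients at the other free degrees are `0`.

Each block is chosen (`exists_block`) so that `P_{n N}` has valence greater than `j N`, and so that
`P_{n N}(D) (u N)` is close to a prescribed target `y N`; afterwards `j (N + 1)` is chosen so large
that `2 ^ j (N + 1)` exceeds the constant in the Cauchy estimate for `P_{n N}(D)`. For `h ∈ M`,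
the operator `P_{n N}(D)` then annihilates all terms of `h` of degree at most `j N`, sends the
block to `a • P_{n N}(D) (u N) ≈ a • y N`, and the rest has size at most
`∑_{l ≥ j (N + 1)} |h_l| (2 (R + 1)) ^ l` on the disc of radius `R`, a tail of a convergent series
(`norm_diffOp_sub_le`). If `h ≠ 0`, some free coefficient `a` is nonzero; as each free degree is
attached to blocks with targets running infinitely often through a dense sequence, the orbit of `h`
is dense.

The blocks exist as soon as the functions with arbitrarily small preimages under `P_n(D)`
(`smallPreimages`) are dense, along indices with valences tending to infinity. Under (P) they contain
the exponentials `exp (w z)`, `w ∈ U`, which are eigenfunctions, and these span a dense subspace by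
Hahn-Banach (`UnicitySet.discDense_span_expFun`). Property (R) is a special case of (P), since a
circle is a unicity set (`unicitySet_sphere`). Under (Q) they contain the monomials: inverting
`P_n(D)` on polynomials amounts to a triangular system followed by an `m(n)`-fold integration, and
the factor `1 / m(n)!` of the latter outweighs the powers of `1 / |c_{m(n),n}|`
(`exists_preimage_X_pow`, `tendsto_leading_pow_mul`).
-/

namespace Hypercyclicity

/-! ### Entire functions and their Taylor coefficients -/

namespace EntireSpace

@[simp] theorem add_apply (f g : EntireSpace) (z : ℂ) : (f + g) z = f z + g z := rfl

@[simp] theorem sub_apply (f g : EntireSpace) (z : ℂ) : (f - g) z = f z - g z := rfl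

@[simp] theorem smul_apply (c : ℂ) (f : EntireSpace) (z : ℂ) : (c • f) z = c * f z := rfl

@[simp] theorem zero_apply (z : ℂ) : (0 : EntireSpace) z = 0 := rfl

/-- The entire function with a given underlying function. -/
def ofDifferentiable (f : ℂ → ℂ) (hf : Differentiable ℂ f) : EntireSpace :=
  ⟨⟨f, hf.continuous⟩, hf⟩

@[simp] theorem coe_ofDifferentiable {f : ℂ → ℂ} (hf : Differentiable ℂ f) :
    ⇑(ofDifferentiable f hf) = f := rfl

theorem continuous_eval (z : ℂ) : Continuous fun f : EntireSpace => f z :=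
  (continuous_eval_const (F := C(ℂ, ℂ)) z).comp continuous_subtype_val

theorem secondCountable : SecondCountableTopology EntireSpace :=
  (Topology.IsInducing.subtypeVal (Y := C(ℂ, ℂ)) (t := entireSubmodule)).secondCountableTopology

theorem tendsto_of_forall_disc {ι : Type*} {l : Filter ι} {F : ι → EntireSpace} {f : EntireSpace}
    (h : ∀ R : ℝ, 0 < R → ∀ ε : ℝ, 0 < ε → ∀ᶠ i in l, ∀ z : ℂ, ‖z‖ ≤ R → ‖F i z - f z‖ ≤ ε) :
    Tendsto F l (𝓝 f) := by
  refine tendsto_subtype_rng.2 ?_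
  rw [ContinuousMap.tendsto_iff_forall_isCompact_tendstoUniformlyOn]
  intro K hK
  obtain ⟨R, hR, hKR⟩ := hK.isBounded.exists_pos_norm_le
  rw [Metric.tendstoUniformlyOn_iff]
  intro ε hε
  filter_upwards [h R hR (ε / 2) (by positivity)] with i hi z hz
  rw [dist_comm, dist_eq_norm]
  exact (hi z (hKR z hz)).trans_lt (by linarith)

/-- The `l`-th Taylor coefficient at the origin, as a continuous linear functional on `H(ℂ)`. -/
noncomputable def taylorCoeff (l : ℕ) : EntireSpace →L[ℂ] ℂ where
  toFun f := ((l.factorial : ℂ)⁻¹) * (D ^ l) f 0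
  map_add' f g := by simp [mul_add]
  map_smul' c f := by simp; ring
  cont := continuous_const.mul ((continuous_eval 0).comp (D ^ l).continuous)

theorem taylorCoeff_eq (l : ℕ) (f : EntireSpace) :
    taylorCoeff l f = ((l.factorial : ℂ)⁻¹) * iteratedDeriv l f 0 := by
  rw [← D_pow_apply]; rfl

theorem hasSum_taylor (f : EntireSpace) (z : ℂ) :
    HasSum (fun l => taylorCoeff l f * z ^ l) (f z) := by
  refine (Complex.hasSum_taylorSeries_of_entire f.differentiable 0 z).congr_fun ?_
  intro l
  rw [taylorCoeff_eq]
  simp only [sub_zero, smul_eq_mul]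
  ring

theorem ext_taylorCoeff {f g : EntireSpace} (h : ∀ l, taylorCoeff l f = taylorCoeff l g) :
    f = g :=
  DFunLike.ext _ _ fun z => (hasSum_taylor f z).unique (by simpa only [h] using hasSum_taylor g z)

theorem norm_iteratedDeriv_le {f : EntireSpace} {w : ℂ} {R ε : ℝ} (hR : 0 < R)
    (h : ∀ z : ℂ, ‖z - w‖ = R → ‖f z‖ ≤ ε) (l : ℕ) :
    ‖iteratedDeriv l f w‖ ≤ l.factorial * ε / R ^ l :=
  Complex.norm_iteratedDeriv_le_of_forall_mem_sphere_norm_le l hR f.differentiable.diffContOnCl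
    fun z hz => h z (by simpa [dist_eq_norm] using hz)

theorem norm_taylorCoeff_mul_pow_le {f : EntireSpace} {R ε : ℝ} (hR : 0 < R)
    (h : ∀ z : ℂ, ‖z‖ = R → ‖f z‖ ≤ ε) (l : ℕ) : ‖taylorCoeff l f‖ * R ^ l ≤ ε := by
  have h1 := norm_iteratedDeriv_le (w := 0) hR (by simpa using h) l
  have hl : (0 : ℝ) < l.factorial := by positivity
  rw [le_div_iff₀ (by positivity)] at h1
  rw [taylorCoeff_eq, norm_mul, norm_inv, Complex.norm_natCast, mul_assoc,
    inv_mul_le_iff₀ hl]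
  exact h1

theorem summable_norm_taylorCoeff (f : EntireSpace) {r : ℝ} (hr : 0 ≤ r) :
    Summable fun l => ‖taylorCoeff l f‖ * r ^ l := by
  simpa [abs_of_nonneg hr] using (hasSum_taylor f (r : ℂ)).summable.norm

/-- Coefficients decaying faster than every geometric sequence are those of an entire function. -/
theorem exists_taylorCoeff_eq {a : ℕ → ℂ}
    (ha : ∀ r : ℝ, 0 < r → ∀ᶠ l in atTop, ‖a l‖ * r ^ l ≤ 1) :
    ∃ f : EntireSpace, ∀ l, taylorCoeff l f = a l := by
  have hrad : (FormalMultilinearSeries.ofScalars ℂ a).radius = ⊤ := by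
    refine FormalMultilinearSeries.radius_eq_top_of_summable_norm _ fun r => ?_
    refine (summable_geometric_of_lt_one (r := 1 / 2) (by norm_num)
      (by norm_num)).of_norm_bounded_eventually_nat ?_
    filter_upwards [ha (2 * (r + 1)) (by positivity)] with l hl
    rw [FormalMultilinearSeries.ofScalars_norm, Real.norm_of_nonneg (by positivity), div_pow,
      one_pow, le_div_iff₀ (by positivity)]
    refine le_trans ?_ hl
    rw [mul_assoc, mul_comm ((r : ℝ) ^ l), ← mul_pow]
    gcongr
    linarith
  have hf := (FormalMultilinearSeries.ofScalars ℂ a).hasFPowerSeriesOnBall (by simp [hrad])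
  rw [hrad] at hf
  have hd : Differentiable ℂ (FormalMultilinearSeries.ofScalars ℂ a).sum := by
    have := hf.differentiableOn
    simpa [differentiableOn_univ] using this
  refine ⟨ofDifferentiable _ hd, fun l => ?_⟩
  have := hf.factorial_smul 1 l
  rw [FormalMultilinearSeries.ofScalars_apply_eq, ← iteratedDeriv_eq_iteratedFDeriv] at this
  rw [taylorCoeff_eq, coe_ofDifferentiable, ← this]
  have hl : (l.factorial : ℂ) ≠ 0 := by exact_mod_cast l.factorial_ne_zero
  simp [hl]

/-- Polynomials as entire functions. -/
noncomputable def ofPoly : ℂ[X] →ₗ[ℂ] EntireSpace where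
  toFun p := ofDifferentiable (fun z => p.eval z) p.differentiable
  map_add' _ _ := DFunLike.ext _ _ fun _ => eval_add
  map_smul' c p := DFunLike.ext _ _ fun z => eval_smul c p z

theorem ofPoly_apply (p : ℂ[X]) (z : ℂ) : ofPoly p z = p.eval z := rfl

theorem D_pow_ofPoly (k : ℕ) (p : ℂ[X]) : (D ^ k) (ofPoly p) = ofPoly (derivative^[k] p) := by
  induction k with
  | zero => rfl
  | succ k ih =>
    rw [pow_succ', mul_apply_eq_comp, ih, Function.iterate_succ_apply']
    exact DFunLike.ext _ _ fun z => Polynomial.deriv _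

theorem taylorCoeff_ofPoly (l : ℕ) (p : ℂ[X]) : taylorCoeff l (ofPoly p) = p.coeff l := by
  have hl : (l.factorial : ℂ) ≠ 0 := by exact_mod_cast l.factorial_ne_zero
  change (l.factorial : ℂ)⁻¹ * (D ^ l) (ofPoly p) 0 = _
  rw [D_pow_ofPoly, ofPoly_apply, ← coeff_zero_eq_eval_zero, coeff_iterate_derivative]
  simp [Nat.descFactorial_self, hl]

/-- The Taylor polynomial of degree less than `L` at the origin. -/
noncomputable def taylorPoly (L : ℕ) (f : EntireSpace) : ℂ[X] :=
  ∑ l ∈ Finset.range L, monomial l (taylorCoeff l f)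

theorem coeff_taylorPoly (L : ℕ) (f : EntireSpace) (l : ℕ) :
    (taylorPoly L f).coeff l = if l < L then taylorCoeff l f else 0 := by
  simp [taylorPoly, coeff_monomial]

theorem natDegree_taylorPoly_lt (L : ℕ) (f : EntireSpace) :
    (taylorPoly (L + 1) f).natDegree < L + 1 :=
  Nat.lt_succ_of_le (natDegree_le_iff_coeff_eq_zero.2 fun l hl => by
    rw [coeff_taylorPoly, if_neg (by omega)])

theorem norm_sub_taylorPoly_le (f : EntireSpace) (L : ℕ) {R : ℝ} {z : ℂ} (hz : ‖z‖ ≤ R) :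
    ‖(f - ofPoly (taylorPoly L f)) z‖ ≤ ∑' l, ‖taylorCoeff (l + L) f‖ * R ^ (l + L) := by
  have hR : 0 ≤ R := (norm_nonneg z).trans hz
  have h1 : HasSum (fun l => taylorCoeff (l + L) f * z ^ (l + L))
      ((f - ofPoly (taylorPoly L f)) z) := by
    rw [sub_apply, ofPoly_apply, taylorPoly, eval_finsetSum]
    simpa only [eval_monomial] using (hasSum_nat_add_iff' L).2 (hasSum_taylor f z)
  refine h1.norm_le_of_bounded ((summable_nat_add_iff L).2
    (summable_norm_taylorCoeff f hR)).hasSum fun l => ?_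
  rw [norm_mul, norm_pow]
  gcongr

theorem tendsto_tail (f : EntireSpace) (R : ℝ) :
    Tendsto (fun L => ∑' l, ‖taylorCoeff (l + L) f‖ * R ^ (l + L)) atTop (𝓝 0) :=
  tendsto_sum_nat_add fun l => ‖taylorCoeff l f‖ * R ^ l

theorem exists_taylorPoly_close (f : EntireSpace) (R : ℝ) {ε : ℝ} (hε : 0 < ε) :
    ∀ᶠ L in atTop, ∀ z : ℂ, ‖z‖ ≤ R → ‖(f - ofPoly (taylorPoly L f)) z‖ ≤ ε := by
  filter_upwards [(tendsto_tail f R).eventually_lt_const hε] with L hL z hz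
  exact (norm_sub_taylorPoly_le f L hz).trans hL.le

end EntireSpace

open EntireSpace

/-! ### Differential operators on polynomials and on discs -/

theorem diffOp_ofPoly_eq_zero {P : ℂ[X]} {p : ℂ[X]} (h : p.natDegree < valence P) :
    diffOp P (ofPoly p) = 0 := by
  obtain ⟨Q, hQ⟩ : (X : ℂ[X]) ^ valence P ∣ P := by
    rw [X_pow_dvd_iff]
    exact fun d hd => coeff_eq_zero_of_lt_natTrailingDegree hd
  have : diffOp P = aeval D Q * D ^ valence P := by
    conv_lhs => rw [hQ, mul_comm]
    simp [diffOp]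
  rw [this, mul_apply_eq_comp, D_pow_ofPoly, iterate_derivative_eq_zero h]
  simp

/-- The constant `∑ |c_j| j!` that the Cauchy estimates on circles of radius `1` give for `P(D)`,
see `norm_diffOp_le`. -/
noncomputable def cauchyConst (P : ℂ[X]) : ℝ :=
  ∑ j ∈ Finset.range (P.natDegree + 1), ‖P.coeff j‖ * j.factorial

theorem cauchyConst_nonneg (P : ℂ[X]) : 0 ≤ cauchyConst P :=
  Finset.sum_nonneg fun _ _ => by positivity

/-- A bound for `P(D)` on discs in which the loss of radius does not depend on `P`; this is what lets
the construction handle infinitely many operators at once. -/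
theorem norm_diffOp_le (P : ℂ[X]) {f : EntireSpace} {R ε : ℝ}
    (h : ∀ z : ℂ, ‖z‖ ≤ R + 1 → ‖f z‖ ≤ ε) {z : ℂ} (hz : ‖z‖ ≤ R) :
    ‖diffOp P f z‖ ≤ cauchyConst P * ε := by
  rw [diffOp_apply, cauchyConst, Finset.sum_mul]
  refine norm_sum_le_of_le _ fun j _ => ?_
  have := norm_iteratedDeriv_le (f := f) (w := z) (R := 1) (ε := ε) one_pos (fun w hw => h w ?_) j
  · rw [norm_mul, mul_assoc]
    gcongr
    simpa using this
  · calc ‖w‖ = ‖z + (w - z)‖ := by ring_nf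
      _ ≤ ‖z‖ + ‖w - z‖ := norm_add_le _ _
      _ ≤ R + 1 := by rw [hw]; linarith

/-! ### Small preimages -/

/-- The entire functions that have, eventually along `F`, arbitrarily small preimages under the
operators `P_n(D)`. -/
noncomputable def smallPreimages (P : ℕ → ℂ[X]) (F : Filter ℕ) : Submodule ℂ EntireSpace where
  carrier := {f | ∀ R : ℝ, 0 < R → ∀ ε : ℝ, 0 < ε → ∀ᶠ n in F,
    ∃ u : EntireSpace, (∀ z : ℂ, ‖z‖ ≤ R → ‖u z‖ ≤ ε) ∧ diffOp (P n) u = f}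
  add_mem' := by
    intro f g hf hg R hR ε hε
    filter_upwards [hf R hR (ε / 2) (by positivity), hg R hR (ε / 2) (by positivity)]
    rintro n ⟨u, hu, rfl⟩ ⟨v, hv, rfl⟩
    refine ⟨u + v, fun z hz => ?_, map_add _ _ _⟩
    rw [add_apply]
    linarith [norm_add_le (u z) (v z), hu z hz, hv z hz]
  zero_mem' := fun R _ ε hε => Eventually.of_forall fun n =>
    ⟨0, fun z _ => by simpa using hε.le, map_zero _⟩
  smul_mem' := by
    intro c f hf R hR ε hε
    filter_upwards [hf R hR (ε / (‖c‖ + 1)) (by positivity)]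
    rintro n ⟨u, hu, rfl⟩
    refine ⟨c • u, fun z hz => ?_, map_smul _ _ _⟩
    rw [smul_apply, norm_mul]
    calc ‖c‖ * ‖u z‖ ≤ (‖c‖ + 1) * (ε / (‖c‖ + 1)) := by
          gcongr
          · linarith
          · exact hu z hz
      _ = ε := by field_simp

theorem mem_smallPreimages {P : ℕ → ℂ[X]} {F : Filter ℕ} {f : EntireSpace} :
    f ∈ smallPreimages P F ↔ ∀ R : ℝ, 0 < R → ∀ ε : ℝ, 0 < ε → ∀ᶠ n in F,
      ∃ u : EntireSpace, (∀ z : ℂ, ‖z‖ ≤ R → ‖u z‖ ≤ ε) ∧ diffOp (P n) u = f := Iff.rfl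

/-- Density of a set of entire functions for uniform convergence on compact sets, expressed by
approximation on discs around the origin. -/
def DiscDense (A : Set EntireSpace) : Prop :=
  ∀ (f : EntireSpace) (R : ℝ), 0 < R → ∀ ε : ℝ, 0 < ε →
    ∃ g ∈ A, ∀ z : ℂ, ‖z‖ ≤ R → ‖(f - g) z‖ ≤ ε

theorem DiscDense.mono {A B : Set EntireSpace} (h : DiscDense A) (hAB : A ⊆ B) : DiscDense B :=
  fun f R hR ε hε => (h f R hR ε hε).imp fun _ hg => ⟨hAB hg.1, hg.2⟩

theorem discDense_of_ofPoly_X_pow_mem {A : Submodule ℂ EntireSpace}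
    (h : ∀ s : ℕ, ofPoly (X ^ s) ∈ A) : DiscDense (A : Set EntireSpace) := by
  intro f R _ ε hε
  obtain ⟨L, hL⟩ := (exists_taylorPoly_close f R hε).exists
  refine ⟨_, ?_, hL⟩
  rw [taylorPoly, map_sum]
  refine A.sum_mem fun l _ => ?_
  rw [← C_mul_X_pow_eq_monomial, ← smul_eq_C_mul, map_smul]
  exact A.smul_mem _ (h l)

/-! ### Exponentials and unicity sets -/

/-- The exponential `z ↦ exp (w z)`. -/
noncomputable def expFun (w : ℂ) : EntireSpace :=
  ofDifferentiable (fun z => Complex.exp (w * z)) (by fun_prop)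

theorem diffOp_expFun (P : ℂ[X]) (w : ℂ) : diffOp P (expFun w) = P.eval w • expFun w := by
  refine DFunLike.ext _ _ fun z => ?_
  rw [diffOp_apply, smul_apply, eval_eq_sum_range, Finset.sum_mul]
  refine Finset.sum_congr rfl fun j _ => ?_
  rw [expFun, coe_ofDifferentiable, iteratedDeriv_cexp_const_mul]
  ring

/-- The preimages are `exp (w z) / P_n(w)`, since `exp (w z)` is an eigenfunction of `P_n(D)`. -/
theorem expFun_mem_smallPreimages {P : ℕ → ℂ[X]} {F : Filter ℕ} {w : ℂ}
    (h : Tendsto (fun n => ‖(P n).eval w‖) F atTop) : expFun w ∈ smallPreimages P F := by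
  intro R hR ε hε
  filter_upwards [h.eventually_ge_atTop (Real.exp (‖w‖ * R) / ε), h.eventually_gt_atTop 0]
    with n hn hn0
  refine ⟨((P n).eval w)⁻¹ • expFun w, fun z hz => ?_, ?_⟩
  · have h1 : ‖expFun w z‖ ≤ Real.exp (‖w‖ * R) := by
      refine (Complex.norm_exp_le_exp_norm _).trans ?_
      rw [norm_mul]
      gcongr
    rw [smul_apply, norm_mul, norm_inv, inv_mul_le_iff₀ hn0]
    rw [div_le_iff₀ hε] at hn
    exact h1.trans hn
  · rw [map_smul, diffOp_expFun, inv_smul_smul₀ (norm_pos_iff.1 hn0)]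

/-- By the Cauchy estimates, a circle around the origin is a unicity set even for the class of
all entire functions. -/
theorem unicitySet_sphere {r : ℝ} (hr : 0 < r) : UnicitySet (Metric.sphere 0 r) := by
  intro f _ hf
  refine ext_taylorCoeff fun l => ?_
  have h := norm_taylorCoeff_mul_pow_le (f := f) (ε := 0) hr
    (fun z hz => by simp [hf z (by simpa using hz)]) l
  have : ‖taylorCoeff l f‖ ≤ 0 := by
    by_contra! hc
    exact absurd h (not_le.2 (by positivity))
  simpa using this

theorem PropertyR.propertyP {P : ℕ → ℂ[X]} (h : PropertyR P) : PropertyP P := by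
  obtain ⟨r, hr, h⟩ := h
  refine ⟨_, unicitySet_sphere hr, fun z hz => tendsto_atTop_mono (fun n => ?_) h⟩
  exact csInf_le ⟨0, by rintro _ ⟨w, _, rfl⟩; positivity⟩ ⟨z, hz, rfl⟩

/-- Exponentials with frequencies in a unicity set span a dense subspace: the transform
`w ↦ L (exp (w z))` of a functional `L` that annihilates them is of exponential type, so it
vanishes, and its Taylor coefficients are the values of `L` at the monomials, up to factorials. -/
theorem UnicitySet.discDense_span_expFun {U : Set ℂ} (hU : UnicitySet U) :
    DiscDense (Submodule.span ℂ (expFun '' U) : Set EntireSpace) := by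
  intro y R hR ε hε
  let K := Metric.closedBall (0 : ℂ) R
  have : CompactSpace K := isCompact_iff_compactSpace.1 (isCompact_closedBall 0 R)
  let ρ : EntireSpace →ₗ[ℂ] C(K, ℂ) :=
    { toFun := fun f => ⟨fun z => f z, f.differentiable.continuous.comp continuous_subtype_val⟩
      map_add' := fun _ _ => rfl
      map_smul' := fun _ _ => rfl }
  have hρ : ∀ f z, ρ f z = f z := fun _ _ => rfl
  have hρle : ∀ (f : EntireSpace) (δ : ℝ), 0 ≤ δ → (‖ρ f‖ ≤ δ ↔ ∀ z : ℂ, ‖z‖ ≤ R → ‖f z‖ ≤ δ) := by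
    intro f δ hδ
    rw [ContinuousMap.norm_le _ hδ]
    exact ⟨fun h z hz => h ⟨z, by simpa [K] using hz⟩, fun h z => h z (mem_closedBall_zero_iff.1 z.2)⟩
  let S : Submodule ℂ C(K, ℂ) := ((Submodule.span ℂ (expFun '' U)).map ρ).topologicalClosure
  suffices hy : ρ y ∈ S by
    obtain ⟨_, ⟨g, hg, rfl⟩, hd⟩ := Metric.mem_closure_iff.1 hy ε hε
    refine ⟨g, hg, (hρle _ _ hε.le).1 ?_⟩
    rw [map_sub, ← dist_eq_norm]
    exact hd.le
  by_contra hy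
  have : IsClosed (S : Set C(K, ℂ)) := Submodule.isClosed_topologicalClosure _
  -- Hahn-Banach, in the quotient by the closed subspace `S`.
  obtain ⟨L, hLS, hLy⟩ : ∃ L : C(K, ℂ) →L[ℂ] ℂ, (∀ x ∈ S, L x = 0) ∧ L (ρ y) ≠ 0 := by
    obtain ⟨g, hg⟩ := SeparatingDual.exists_ne_zero (R := ℂ) (x := S.mkQL (ρ y))
      (by simpa using hy)
    exact ⟨g.comp S.mkQL, fun x hx => by
      simp [(Submodule.Quotient.mk_eq_zero S).2 hx], hg⟩
  have hexp : ∀ w, HasSum (fun k : ℕ => ((k.factorial : ℂ)⁻¹ * w ^ k) • ρ (ofPoly (X ^ k)))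
      (ρ (expFun w)) := by
    intro w
    have h := NormedSpace.exp_series_hasSum_exp' (𝕂 := ℂ) (w • ρ (ofPoly X))
    have hz : ∀ z : K, NormedSpace.exp (w • ρ (ofPoly X)) z = ρ (expFun w) z := by
      intro z
      refine (ContinuousMap.hasSum_apply h z).unique ?_
      have := NormedSpace.exp_series_hasSum_exp' (𝕂 := ℂ) (w * (z : ℂ))
      rw [← Complex.exp_eq_exp_ℂ] at this
      simpa [hρ, ofPoly_apply, expFun] using this
    rw [ContinuousMap.ext hz] at h
    refine h.congr_fun fun k => ContinuousMap.ext fun z => ?_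
    simp [hρ, ofPoly_apply, mul_pow, mul_assoc]
  have hLk : ∀ k : ℕ, ‖L (ρ (ofPoly (X ^ k)))‖ ≤ ‖L‖ * R ^ k := fun k =>
    L.le_of_opNorm_le_of_le le_rfl ((hρle _ _ (by positivity)).2 fun z hz => by
      rw [ofPoly_apply, eval_pow, eval_X, norm_pow]
      gcongr)
  -- The transform `w ↦ L (exp (w z))`, as the entire function `f`.
  obtain ⟨f, hf⟩ := exists_taylorCoeff_eq
      (a := fun k => (k.factorial : ℂ)⁻¹ * L (ρ (ofPoly (X ^ k)))) (by
    intro r hr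
    have h := (FloorSemiring.tendsto_pow_div_factorial_atTop (R * r)).const_mul ‖L‖
    rw [mul_zero] at h
    filter_upwards [h.eventually_le_const one_pos] with k hk
    refine le_trans ?_ hk
    rw [norm_mul, norm_inv, Complex.norm_natCast, mul_pow]
    calc _ ≤ (k.factorial : ℝ)⁻¹ * (‖L‖ * R ^ k) * r ^ k := by gcongr; exact hLk k
      _ = _ := by ring)
  have hfw : ∀ w, f w = L (ρ (expFun w)) := by
    intro w
    refine (hasSum_taylor f w).unique (((hexp w).mapL L).congr_fun fun k => ?_)
    rw [hf, map_smul, smul_eq_mul]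
    ring
  have hf0 : f = 0 := by
    refine hU f ⟨‖L‖ + 1, R, by positivity, hR, fun w => ?_⟩ fun w hw => ?_
    · rw [hfw]
      refine (L.le_of_opNorm_le_of_le (le_add_of_nonneg_right zero_le_one)
        ((hρle _ (Real.exp (R * ‖w‖)) (by positivity)).2 fun z hz => ?_))
      refine (Complex.norm_exp_le_exp_norm _).trans ?_
      rw [norm_mul, mul_comm]
      gcongr
    · rw [hfw]
      exact hLS _ (Submodule.le_topologicalClosure _
        (Submodule.mem_map_of_mem (Submodule.subset_span ⟨w, hw, rfl⟩)))
  -- Hence `L` annihilates the monomials, and so every entire function.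
  have hker : ∀ k, ofPoly (X ^ k) ∈ LinearMap.ker (L.toLinearMap ∘ₗ ρ) := by
    intro k
    have h := hf k
    rw [hf0, map_zero, eq_comm] at h
    simpa [Nat.factorial_ne_zero] using h
  obtain ⟨g, hg, hyg⟩ := discDense_of_ofPoly_X_pow_mem hker y R hR
    (‖L (ρ y)‖ / (2 * (‖L‖ + 1))) (by positivity)
  have hg0 : L (ρ g) = 0 := hg
  have h := L.le_of_opNorm_le_of_le (le_add_of_nonneg_right zero_le_one)
    ((hρle _ _ (by positivity)).2 hyg)
  rw [map_sub, map_sub, hg0, sub_zero] at h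
  have h2 : 0 < ‖L (ρ y)‖ := norm_pos_iff.2 hLy
  have h3 : (‖L‖ + 1) * (‖L (ρ y)‖ / (2 * (‖L‖ + 1))) = ‖L (ρ y)‖ / 2 := by field_simp
  linarith

theorem PropertyP.discDense_smallPreimages {P : ℕ → ℂ[X]} (h : PropertyP P) {F : Filter ℕ}
    (hF : F ≤ atTop) : DiscDense (smallPreimages P F : Set EntireSpace) := by
  obtain ⟨U, hU, h⟩ := h
  refine hU.discDense_span_expFun.mono (Submodule.span_le.2 ?_)
  rintro _ ⟨w, hw, rfl⟩
  exact expFun_mem_smallPreimages ((h w hw).mono_left hF)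

/-! ### Small preimages of monomials -/

theorem taylorCoeff_D_pow (t j : ℕ) (f : EntireSpace) :
    taylorCoeff t ((D ^ j) f) = ((t + j).factorial / t.factorial : ℂ) * taylorCoeff (t + j) f := by
  change (t.factorial : ℂ)⁻¹ * (D ^ t) ((D ^ j) f) 0
    = _ * (((t + j).factorial : ℂ)⁻¹ * (D ^ (t + j)) f 0)
  have : ((t + j).factorial : ℂ) ≠ 0 := by exact_mod_cast (t + j).factorial_ne_zero
  rw [pow_add, mul_apply_eq_comp]
  field_simp

theorem taylorCoeff_diffOp (P : ℂ[X]) (f : EntireSpace) (t : ℕ) :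
    taylorCoeff t (diffOp P f) = ∑ j ∈ Finset.range (P.natDegree + 1),
      P.coeff j * (((t + j).factorial / t.factorial : ℂ) * taylorCoeff (t + j) f) := by
  have : diffOp P f = ∑ j ∈ Finset.range (P.natDegree + 1), P.coeff j • (D ^ j) f := by
    rw [diffOp, aeval_eq_sum_range]
    simp
  simp only [this, map_sum, map_smul, taylorCoeff_D_pow, smul_eq_mul]

/-- With `m` the valence of `P`, the operator `P(D)` sends `s! z^(m+s) / (m+s)!` to `c_m z^s` plus
terms of lower degree, whose coefficients only involve `c_(m+1), …, c_(m+s)`. -/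
theorem diffOp_monomial (P : ℂ[X]) (s : ℕ) :
    diffOp P (ofPoly (monomial (valence P + s) (s.factorial / (valence P + s).factorial : ℂ)))
      = P.coeff (valence P) • ofPoly (X ^ s) + ∑ t ∈ Finset.range s,
        (P.coeff (s - t + valence P) * (s.factorial / t.factorial : ℂ)) • ofPoly (X ^ t) := by
  set m := valence P with hm
  have hfac : ∀ a : ℕ, (a.factorial : ℂ) ≠ 0 := fun a => by exact_mod_cast a.factorial_ne_zero
  refine ext_taylorCoeff fun t => ?_
  rw [taylorCoeff_diffOp]
  simp only [map_add, map_sum, map_smul, taylorCoeff_ofPoly, coeff_monomial, coeff_X_pow,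
    smul_eq_mul, mul_ite, mul_one, mul_zero, Finset.sum_ite_eq, Finset.mem_range]
  rcases lt_or_ge (m + s) t with hts | hts
  · rw [Finset.sum_eq_zero fun j _ => if_neg (by omega), if_neg (by omega), if_neg (by omega),
      add_zero]
  rw [Finset.sum_eq_single (m + s - t)]
  · rw [if_pos (by omega), show t + (m + s - t) = m + s by omega]
    rcases lt_trichotomy t s with h | rfl | h
    · rw [if_neg (by omega), if_pos h, show s - t + m = m + s - t by omega]
      field_simp [hfac]
      ring
    · rw [if_pos rfl, if_neg (by omega), show m + t - t = m by omega]
      field_simp [hfac]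
      ring
    · have : P.coeff (m + s - t) = 0 :=
        coeff_eq_zero_of_lt_natTrailingDegree (by change _ < m; omega)
      rw [if_neg (by omega), if_neg (by omega), this, zero_mul, add_zero]
  · exact fun j _ hj => if_neg (by omega)
  · intro hj
    rw [coeff_eq_zero_of_natDegree_lt (by rw [Finset.mem_range] at hj; omega), zero_mul, ite_self]

/-- The preimages of `z^s` found by solving the triangular system `diffOp_monomial`; their size is
controlled by a power of `1 / |c_m|`, with constants that do not depend on `n`. -/
theorem exists_preimage_X_pow {P : ℕ → ℂ[X]} (hP : ∀ n, P n ≠ 0)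
    (hb : ∀ k : ℕ, 1 ≤ k → ∃ C : ℝ, ∀ n, ‖(P n).coeff (k + valence (P n))‖ ≤ C)
    {R : ℝ} (hR : 0 < R) (s : ℕ) :
    ∃ B : ℝ, 0 ≤ B ∧ ∀ n, ∃ u : EntireSpace, diffOp (P n) u = ofPoly (X ^ s) ∧
      ∀ z : ℂ, ‖z‖ ≤ R → ‖u z‖ ≤ B * (max 1 ‖(P n).coeff (valence (P n))‖⁻¹) ^ (s + 1) *
        (R ^ valence (P n) / (valence (P n)).factorial) := by
  induction s using Nat.strong_induction_on with
  | _ s ih =>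
    have hb' : ∀ k : ℕ, ∃ C : ℝ, 1 ≤ k → ∀ n, ‖(P n).coeff (k + valence (P n))‖ ≤ C := fun k => by
      by_cases hk : 1 ≤ k
      · exact (hb k hk).imp fun _ h _ => h
      · exact ⟨0, fun h => absurd h hk⟩
    choose C hC using hb'
    have ih' : ∀ t, ∃ B : ℝ, t < s → 0 ≤ B ∧ ∀ n, ∃ u : EntireSpace,
        diffOp (P n) u = ofPoly (X ^ t) ∧ ∀ z : ℂ, ‖z‖ ≤ R → ‖u z‖ ≤
          B * (max 1 ‖(P n).coeff (valence (P n))‖⁻¹) ^ (t + 1) *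
            (R ^ valence (P n) / (valence (P n)).factorial) := fun t => by
      by_cases ht : t < s
      · exact (ih t ht).imp fun _ h _ => h
      · exact ⟨0, fun h => absurd h ht⟩
    choose B hB using ih'
    have hC0 : ∀ k, 1 ≤ k → 0 ≤ C k := fun k hk => (norm_nonneg _).trans (hC k hk 0)
    have hB0 : ∀ t ∈ Finset.range s, 0 ≤ C (s - t) * (s.factorial / t.factorial : ℝ) * B t := by
      intro t ht
      rw [Finset.mem_range] at ht
      have := hC0 (s - t) (by omega)
      have := (hB t ht).1
      positivity
    refine ⟨s.factorial * R ^ s +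
      ∑ t ∈ Finset.range s, C (s - t) * (s.factorial / t.factorial : ℝ) * B t,
      add_nonneg (by positivity) (Finset.sum_nonneg hB0), fun n => ?_⟩
    have hu : ∀ t, ∃ u : EntireSpace, t < s → diffOp (P n) u = ofPoly (X ^ t) ∧
        ∀ z : ℂ, ‖z‖ ≤ R → ‖u z‖ ≤ B t * (max 1 ‖(P n).coeff (valence (P n))‖⁻¹) ^ (t + 1) *
            (R ^ valence (P n) / (valence (P n)).factorial) := fun t => by
      by_cases ht : t < s
      · exact ((hB t ht).2 n).imp fun _ h _ => h
      · exact ⟨0, fun h => absurd h ht⟩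
    choose u hu using hu
    set m := valence (P n) with hm
    set c := (P n).coeff m with hc
    have hc0 : c ≠ 0 := by
      rw [hc, hm, valence, ← trailingCoeff, Ne, trailingCoeff_eq_zero]
      exact hP n
    set μ := max 1 ‖c‖⁻¹ with hμ
    have hμ1 : 1 ≤ μ := le_max_left _ _
    set G := R ^ m / m.factorial with hG
    have hG0 : 0 ≤ G := by positivity
    refine ⟨c⁻¹ • (ofPoly (monomial (m + s) (s.factorial / (m + s).factorial : ℂ)) -
      ∑ t ∈ Finset.range s,
        ((P n).coeff (s - t + m) * (s.factorial / t.factorial : ℂ)) • u t), ?_, fun z hz => ?_⟩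
    · have hsum : diffOp (P n) (∑ t ∈ Finset.range s,
          ((P n).coeff (s - t + m) * (s.factorial / t.factorial : ℂ)) • u t) = ∑ t ∈ Finset.range s,
          ((P n).coeff (s - t + m) * (s.factorial / t.factorial : ℂ)) • ofPoly (X ^ t) := by
        rw [map_sum]
        exact Finset.sum_congr rfl fun t ht => by rw [map_smul, (hu t (Finset.mem_range.1 ht)).1]
      rw [map_smul, map_sub, diffOp_monomial, hsum, add_sub_cancel_right, inv_smul_smul₀ hc0]
    · have hsum : (∑ t ∈ Finset.range s,
          ((P n).coeff (s - t + m) * (s.factorial / t.factorial : ℂ)) • u t) z =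
          ∑ t ∈ Finset.range s,
            ((P n).coeff (s - t + m) * (s.factorial / t.factorial : ℂ)) * u t z :=
        map_sum (⟨⟨fun f : EntireSpace => f z, rfl⟩, fun _ _ => rfl⟩ : EntireSpace →+ ℂ) _ _
      have h1 : ‖ofPoly (monomial (m + s) (s.factorial / (m + s).factorial : ℂ)) z‖
          ≤ s.factorial * R ^ s * μ ^ s * G := by
        rw [ofPoly_apply, eval_monomial, norm_mul, norm_div, norm_pow, Complex.norm_natCast,
          Complex.norm_natCast]
        have hfac : (m.factorial : ℝ) ≤ (m + s).factorial := by
          exact_mod_cast Nat.factorial_le (Nat.le_add_right m s)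
        calc _ ≤ (s.factorial / m.factorial : ℝ) * R ^ (m + s) := by gcongr
          _ = s.factorial * R ^ s * 1 * G := by rw [hG]; ring
          _ ≤ _ := by gcongr; exact one_le_pow₀ hμ1
      have h2 : ∀ t ∈ Finset.range s,
          ‖((P n).coeff (s - t + m) * (s.factorial / t.factorial : ℂ)) * u t z‖
            ≤ C (s - t) * (s.factorial / t.factorial : ℝ) * B t * (μ ^ s * G) := by
        intro t ht
        rw [Finset.mem_range] at ht
        have hBt := (hB t ht).1
        have hCt := hC0 (s - t) (by omega)
        rw [norm_mul, norm_mul, norm_div, Complex.norm_natCast, Complex.norm_natCast]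
        calc _ ≤ C (s - t) * (s.factorial / t.factorial : ℝ) * (B t * μ ^ (t + 1) * G) := by
              gcongr
              · exact hC (s - t) (by omega) n
              · exact (hu t ht).2 z hz
          _ ≤ C (s - t) * (s.factorial / t.factorial : ℝ) * (B t * μ ^ s * G) := by
              gcongr _ * (_ * ?_ * _)
              exact pow_le_pow_right₀ hμ1 ht
          _ = _ := by ring
      rw [EntireSpace.smul_apply, EntireSpace.sub_apply, hsum, norm_mul, norm_inv]
      calc _ ≤ μ * (s.factorial * R ^ s * μ ^ s * G + ∑ t ∈ Finset.range s,
            C (s - t) * (s.factorial / t.factorial : ℝ) * B t * (μ ^ s * G)) := by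
            gcongr
            · exact le_max_right _ _
            · exact (norm_sub_le _ _).trans (add_le_add h1 (norm_sum_le_of_le _ h2))
        _ = _ := by rw [← Finset.sum_mul]; ring

/-- Property (Q) beats the constants of `exists_preimage_X_pow`, because `m^m / m! ≤ e^m`. -/
theorem tendsto_leading_pow_mul {P : ℕ → ℂ[X]} (hP : ∀ n, P n ≠ 0) {F : Filter ℕ} (hF : F ≤ atTop)
    (hval : Tendsto (fun n => valence (P n)) F atTop) {k : ℕ}
    (hk : Tendsto (fun n => (valence (P n) : ℝ) *
      ‖(P n).coeff (valence (P n))‖ ^ ((k : ℝ) / (valence (P n) : ℝ))) atTop atTop)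
    {R : ℝ} (hR : 0 < R) :
    Tendsto (fun n => (max 1 ‖(P n).coeff (valence (P n))‖⁻¹) ^ k *
      (R ^ valence (P n) / (valence (P n)).factorial)) F (𝓝 0) := by
  have h1 : Tendsto (fun n => R ^ valence (P n) / ((valence (P n)).factorial : ℝ)
      + (1 / 2) ^ valence (P n)) F (𝓝 (0 + 0)) :=
    ((FloorSemiring.tendsto_pow_div_factorial_atTop R).comp hval).add
      ((tendsto_pow_atTop_nhds_zero_of_lt_one (by norm_num) (by norm_num)).comp hval)
  rw [add_zero] at h1
  refine squeeze_zero' (Eventually.of_forall fun n => by positivity) ?_ h1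
  filter_upwards [hval.eventually_ge_atTop 1,
    hF (hk.eventually_ge_atTop (2 * Real.exp 1 * R))] with n hm hn
  have hc : 0 < ‖(P n).coeff (valence (P n))‖ := by
    rw [norm_pos_iff, valence, ← trailingCoeff, Ne, trailingCoeff_eq_zero]
    exact hP n
  set m := valence (P n)
  set c := ‖(P n).coeff m‖
  have hm0 : (0 : ℝ) < m := by exact_mod_cast hm
  have hmain : (c⁻¹) ^ k * (R ^ m / m.factorial) ≤ (1 / 2) ^ m := by
    have h3 : (2 * Real.exp 1 * R) ^ m ≤ (m : ℝ) ^ m * c ^ k := by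
      calc _ ≤ ((m : ℝ) * c ^ ((k : ℝ) / m)) ^ m := by gcongr
        _ = _ := by
          rw [mul_pow, ← Real.rpow_mul_natCast hc.le, div_mul_cancel₀ _ hm0.ne',
            Real.rpow_natCast]
    have h4 : (m : ℝ) ^ m / m.factorial ≤ Real.exp 1 ^ m := by
      have := Real.pow_div_factorial_le_exp (m : ℝ) hm0.le m
      rwa [← Real.exp_one_pow] at this
    have h5 : (0 : ℝ) < m.factorial := by positivity
    rw [div_le_iff₀ h5] at h4
    have h6 : (2 : ℝ) ^ m * R ^ m ≤ m.factorial * c ^ k := by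
      have : Real.exp 1 ^ m * (2 ^ m * R ^ m) ≤ Real.exp 1 ^ m * (m.factorial * c ^ k) := by
        calc _ = (2 * Real.exp 1 * R) ^ m := by rw [mul_pow, mul_pow]; ring
          _ ≤ (m : ℝ) ^ m * c ^ k := h3
          _ ≤ (Real.exp 1 ^ m * m.factorial) * c ^ k := by gcongr
          _ = _ := by ring
      exact le_of_mul_le_mul_left this (by positivity)
    rw [inv_pow, div_pow, one_pow, inv_mul_eq_div, div_div, div_le_div_iff₀ (by positivity)
      (by positivity)]
    linarith
  rcases max_cases 1 c⁻¹ with ⟨h, -⟩ | ⟨h, -⟩ <;> rw [h]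
  · rw [one_pow, one_mul]
    exact le_add_of_nonneg_right (by positivity)
  · exact hmain.trans (le_add_of_nonneg_left (by positivity))

theorem PropertyQ.discDense_smallPreimages {P : ℕ → ℂ[X]} (h : PropertyQ P) (hP : ∀ n, P n ≠ 0)
    {F : Filter ℕ} (hF : F ≤ atTop) (hval : Tendsto (fun n => valence (P n)) F atTop) :
    DiscDense (smallPreimages P F : Set EntireSpace) := by
  refine discDense_of_ofPoly_X_pow_mem fun s R hR ε hε => ?_
  obtain ⟨B, -, hB⟩ := exists_preimage_X_pow hP (fun k hk => (h k hk).2) hR s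
  have hlim := (tendsto_leading_pow_mul hP hF hval (h (s + 1) (by omega)).1 hR).const_mul B
  rw [mul_zero] at hlim
  filter_upwards [hlim.eventually_le_const hε] with n hn
  obtain ⟨u, hu, hle⟩ := hB n
  exact ⟨u, fun z hz => (hle z hz).trans (by rwa [mul_assoc]), hu⟩

/-! ### The block construction -/

/-- One block of the construction: a polynomial `u` supported in degrees strictly between `j` and
`j'`, with small coefficients, such that `P_n(D) u` is close to `y`, where `P_n(D)` annihilates
the degrees up to `j`, and its Cauchy constant is dominated by `2 ^ j'`. -/
theorem exists_block {P : ℕ → ℂ[X]} {F : Filter ℕ} [F.NeBot]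
    (hval : Tendsto (fun n => valence (P n)) F atTop)
    (hd : DiscDense (smallPreimages P F : Set EntireSpace)) (y : EntireSpace)
    {R ε : ℝ} (hR : 0 < R) (hε : 0 < ε) (j : ℕ) :
    ∃ (n : ℕ) (u : ℂ[X]) (j' : ℕ), j < valence (P n) ∧ j < j' ∧
      (∀ l, l ≤ j ∨ j' ≤ l → u.coeff l = 0) ∧ (∀ l, ‖u.coeff l‖ * R ^ l ≤ 1) ∧
      (∀ z : ℂ, ‖z‖ ≤ R → ‖(diffOp (P n) (ofPoly u) - y) z‖ ≤ ε) ∧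
      cauchyConst (P n) ≤ 2 ^ j' := by
  obtain ⟨g, hg, hyg⟩ := hd y R hR (ε / 2) (by positivity)
  obtain ⟨n, ⟨w, hw, hwg⟩, hn⟩ :=
    ((mem_smallPreimages.1 hg R hR 1 one_pos).and (hval.eventually_gt_atTop j)).exists
  have hC := cauchyConst_nonneg (P n)
  obtain ⟨L, hL, hjL, hCL⟩ := ((exists_taylorPoly_close w (R + 1)
    (ε := ε / (2 * (cauchyConst (P n) + 1))) (by positivity)).and
    ((eventually_gt_atTop j).and
      ((tendsto_pow_atTop_atTop_of_one_lt (one_lt_two (α := ℝ))).eventually_ge_atTop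
        (cauchyConst (P n))))).exists
  have hcoeff : ∀ l, (taylorPoly L w - taylorPoly (j + 1) w).coeff l =
      if j < l ∧ l < L then taylorCoeff l w else 0 := by
    intro l
    rw [coeff_sub, coeff_taylorPoly, coeff_taylorPoly]
    split_ifs <;> first | omega | simp
  refine ⟨n, taylorPoly L w - taylorPoly (j + 1) w, L, hn, hjL, fun l hl => ?_, fun l => ?_,
    fun z hz => ?_, hCL⟩
  · rw [hcoeff, if_neg (by omega)]
  · rw [hcoeff]
    split_ifs
    · exact norm_taylorCoeff_mul_pow_le hR (fun z hz => hw z hz.le) l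
    · simp
  · have h0 : diffOp (P n) (ofPoly (taylorPoly (j + 1) w)) = 0 :=
      diffOp_ofPoly_eq_zero ((natDegree_taylorPoly_lt j w).trans_le hn)
    have h1 : diffOp (P n) (ofPoly (taylorPoly L w - taylorPoly (j + 1) w)) - y
        = -(diffOp (P n) (w - ofPoly (taylorPoly L w))) - (y - g) := by
      rw [map_sub, map_sub, map_sub, h0, hwg]
      abel
    have h2 := norm_diffOp_le (P n) hL hz
    have h3 : cauchyConst (P n) * (ε / (2 * (cauchyConst (P n) + 1))) ≤ ε / 2 := by
      rw [mul_div_assoc', div_le_div_iff₀ (by positivity) (by positivity)]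
      nlinarith
    rw [h1]
    have h4 := norm_sub_le (-(diffOp (P n) (w - ofPoly (taylorPoly L w))) z) ((y - g) z)
    rw [norm_neg] at h4
    exact h4.trans (by linarith [hyg z hz])

/-- Blocks for a sequence of targets, each starting in the degree where the previous one ends. -/
theorem exists_blocks {P : ℕ → ℂ[X]} {F : Filter ℕ} [F.NeBot]
    (hval : Tendsto (fun n => valence (P n)) F atTop)
    (hd : DiscDense (smallPreimages P F : Set EntireSpace)) (y : ℕ → EntireSpace) :
    ∃ (n : ℕ → ℕ) (u : ℕ → ℂ[X]) (j : ℕ → ℕ), j 0 = 0 ∧ ∀ N : ℕ, j N < valence (P (n N)) ∧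
      j N < j (N + 1) ∧
      (∀ l, l ≤ j N ∨ j (N + 1) ≤ l → (u N).coeff l = 0) ∧
      (∀ l, ‖(u N).coeff l‖ * (N + 1 : ℝ) ^ l ≤ 1) ∧
      (∀ z : ℂ, ‖z‖ ≤ N + 1 → ‖(diffOp (P (n N)) (ofPoly (u N)) - y N) z‖ ≤ 1 / (N + 1)) ∧
      cauchyConst (P (n N)) ≤ 2 ^ j (N + 1) := by
  have step : ∀ N j : ℕ, _ := fun N j => exists_block hval hd (y N) (R := N + 1)
    (ε := 1 / (N + 1)) (by positivity) (by positivity) j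
  choose n u j' h using step
  let j : ℕ → ℕ := fun N => Nat.rec 0 (fun N i => j' N i) N
  exact ⟨fun N => n N (j N), fun N => u N (j N), j, rfl, fun N => h N (j N)⟩

/-- As `j 0 = 0`, the intervals `[j N, j (N + 1))` exhaust the degrees. -/
theorem exists_block_index {j : ℕ → ℕ} (hj0 : j 0 = 0) (hj : StrictMono j) (l : ℕ) :
    ∃ N, j N ≤ l ∧ l < j (N + 1) := by
  have hex : ∃ N, l < j (N + 1) := ⟨l, (Nat.lt_succ_self l).trans_le (hj.id_le _)⟩
  refine ⟨Nat.find hex, ?_, Nat.find_spec hex⟩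
  rcases h : Nat.find hex with _ | N
  · omega
  · exact not_lt.1 (Nat.find_min hex (m := N) (by omega))

/-- The entire functions whose coefficients at the degrees `j 0 < j 1 < …` are free, while between
`j N` and `j (N + 1)` they are those of the polynomial `u N`, multiplied by the coefficient at the
free degree `j (i N)`. -/
noncomputable def blockSubspace (j i : ℕ → ℕ) (u : ℕ → ℂ[X]) : Submodule ℂ EntireSpace where
  carrier := {h | ∀ N l, j N < l → l < j (N + 1) →
    taylorCoeff l h = taylorCoeff (j (i N)) h * (u N).coeff l}
  add_mem' := fun hf hg N l h1 h2 => by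
    rw [map_add, map_add, hf N l h1 h2, hg N l h1 h2, add_mul]
  zero_mem' := fun N l _ _ => by simp
  smul_mem' := fun c f hf N l h1 h2 => by
    rw [map_smul, map_smul, hf N l h1 h2, smul_mul_assoc]

theorem isClosed_blockSubspace (j i : ℕ → ℕ) (u : ℕ → ℂ[X]) :
    IsClosed (blockSubspace j i u : Set EntireSpace) := by
  change IsClosed {h : EntireSpace | ∀ N l, j N < l → l < j (N + 1) →
    taylorCoeff l h = taylorCoeff (j (i N)) h * (u N).coeff l}
  simp only [Set.ofPred_forall]
  refine isClosed_iInter fun N => isClosed_iInter fun l => isClosed_iInter fun _ =>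
    isClosed_iInter fun _ => isClosed_eq (taylorCoeff l).continuous ?_
  exact (taylorCoeff (j (i N))).continuous.mul continuous_const

theorem exists_taylorCoeff_ne_zero {j i : ℕ → ℕ} {u : ℕ → ℂ[X]} (hj0 : j 0 = 0)
    (hj : StrictMono j) {h : EntireSpace} (hh : h ∈ blockSubspace j i u) (h0 : h ≠ 0) :
    ∃ k, taylorCoeff (j k) h ≠ 0 := by
  by_contra! hc
  refine h0 (ext_taylorCoeff fun l => ?_)
  obtain ⟨N, hN, hN'⟩ := exists_block_index hj0 hj l
  rcases hN.eq_or_lt with rfl | hN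
  · rw [hc, map_zero]
  · rw [hh N l hN hN', hc, zero_mul, map_zero]

/-- The subspace contains a function for each free degree, dual to the coefficients there. -/
theorem not_finiteDimensional_blockSubspace {j i : ℕ → ℕ} {u : ℕ → ℂ[X]} (hj0 : j 0 = 0)
    (hj : StrictMono j) (hu : ∀ N l, ‖(u N).coeff l‖ * (N + 1 : ℝ) ^ l ≤ 1) :
    ¬ FiniteDimensional ℂ (blockSubspace j i u) := by
  choose b hb hb' using exists_block_index hj0 hj
  have hbN : ∀ N l, j N ≤ l → l < j (N + 1) → b l = N := by
    intro N l h1 h2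
    have h3 := hj.lt_iff_lt.1 (h1.trans_lt (hb' l))
    have h4 := hj.lt_iff_lt.1 ((hb l).trans_lt h2)
    omega
  have hbtop : Tendsto b atTop atTop :=
    tendsto_atTop.2 fun N => (eventually_ge_atTop (j N)).mono fun l hl => by
      have := hj.lt_iff_lt.1 (hl.trans_lt (hb' l))
      omega
  -- `z ^ j k` plus all `u N` with `i N = k`; the bounds on the coefficients make it entire.
  have key : ∀ k, ∃ f : EntireSpace, ∀ l, taylorCoeff l f =
      if l = j (b l) then (if b l = k then 1 else 0)
      else if i (b l) = k then (u (b l)).coeff l else 0 := by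
    intro k
    refine exists_taylorCoeff_eq fun r hr => ?_
    filter_upwards [hbtop.eventually_gt_atTop k, hbtop.eventually_ge_atTop ⌈r⌉₊] with l hlk hlr
    have hr' : r ≤ b l + 1 := (Nat.ceil_le.1 hlr).trans (by linarith)
    split_ifs with h1 h2 h3
    · omega
    · simp
    · exact le_trans (by gcongr) (hu (b l) l)
    · simp
  choose e he using key
  have hej : ∀ k k', taylorCoeff (j k') (e k) = if k' = k then 1 else 0 := by
    intro k k'
    rw [he, hbN k' (j k') le_rfl (hj (Nat.lt_succ_self _)), if_pos rfl]
  have hmem : ∀ k, e k ∈ blockSubspace j i u := by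
    intro k N l h1 h2
    rw [hej, he, hbN N l h1.le h2, if_neg h1.ne']
    simp
  intro hfin
  refine Module.Finite.not_linearIndependent_of_infinite (R := ℂ)
    (fun k => (⟨e k, hmem k⟩ : blockSubspace j i u)) ?_
  rw [linearIndependent_iff']
  intro s c hs k hk
  have h := congrArg (fun f : blockSubspace j i u => taylorCoeff (j k) f) hs
  simpa [hej, hk] using h

/-- Along the blocks, the orbit of `h` is close to `a • y N`, where `a` is the free coefficient that
governs the block: the terms of `h` below the block are annihilated, and the tail above it starts
so late that the factor `2 ^ j (N + 1)` from the Cauchy estimates only doubles the radius. -/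
theorem norm_diffOp_sub_le {j i : ℕ → ℕ} {u : ℕ → ℂ[X]} {h : EntireSpace}
    (hh : h ∈ blockSubspace j i u) {N : ℕ} {P : ℂ[X]} (hP : j N < valence P)
    (hj : j N < j (N + 1)) (hu : ∀ l, l ≤ j N ∨ j (N + 1) ≤ l → (u N).coeff l = 0)
    (hC : cauchyConst P ≤ 2 ^ j (N + 1)) {R : ℝ} {z : ℂ} (hz : ‖z‖ ≤ R) :
    ‖(diffOp P h - taylorCoeff (j (i N)) h • diffOp P (ofPoly (u N))) z‖ ≤
      ∑' l, ‖taylorCoeff (l + j (N + 1)) h‖ * (2 * (R + 1)) ^ (l + j (N + 1)) := by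
  have hR : 0 ≤ R := (norm_nonneg z).trans hz
  set L := j (N + 1)
  set a := taylorCoeff (j (i N)) h
  have hpoly : taylorPoly L h = taylorPoly (j N + 1) h + a • u N := by
    ext l
    rw [coeff_add, coeff_smul, coeff_taylorPoly, coeff_taylorPoly, smul_eq_mul]
    rcases le_or_gt l (j N) with h1 | h1
    · rw [if_pos (by omega), if_pos (by omega), hu l (Or.inl h1), mul_zero, add_zero]
    rcases lt_or_ge l L with h2 | h2
    · rw [if_pos h2, if_neg (by omega), zero_add, hh N l h1 h2]
    · rw [if_neg (by omega), if_neg (by omega), hu l (Or.inr h2), mul_zero, add_zero]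
  have h0 : diffOp P (ofPoly (taylorPoly (j N + 1) h)) = 0 :=
    diffOp_ofPoly_eq_zero ((natDegree_taylorPoly_lt _ h).trans_le hP)
  have h1 : diffOp P h - a • diffOp P (ofPoly (u N)) = diffOp P (h - ofPoly (taylorPoly L h)) := by
    rw [hpoly, map_sub, map_add, map_add, h0, zero_add, map_smul, map_smul]
  rw [h1]
  have hs := (summable_nat_add_iff L).2 (summable_norm_taylorCoeff h (r := R + 1) (by linarith))
  have hs' := (summable_nat_add_iff L).2
    (summable_norm_taylorCoeff h (r := 2 * (R + 1)) (by linarith))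
  refine (norm_diffOp_le P (fun w hw => norm_sub_taylorPoly_le h L hw) hz).trans ?_
  rw [← tsum_mul_left]
  refine (hs.mul_left _).tsum_le_tsum (fun l => ?_) hs'
  have h2 : cauchyConst P ≤ 2 ^ (l + L) :=
    hC.trans (pow_le_pow_right₀ one_le_two (by omega))
  calc _ ≤ 2 ^ (l + L) * (‖taylorCoeff (l + L) h‖ * (R + 1) ^ (l + L)) := by gcongr
    _ = _ := by rw [mul_pow]; ring

/-- The filter `F` isolates the indices that are used: `n → ∞` in such a way that the valences tend to
infinity too. -/
theorem spaceable_HC_of_discDense {P : ℕ → ℂ[X]} {F : Filter ℕ} [F.NeBot]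
    (hval : Tendsto (fun n => valence (P n)) F atTop)
    (hd : DiscDense (smallPreimages P F : Set EntireSpace)) :
    Spaceable (HC fun n => diffOp (P n)) := by
  have := EntireSpace.secondCountable
  let q : ℕ → EntireSpace := TopologicalSpace.denseSeq EntireSpace
  -- Block `N` codes a triple `(k, s, t)`: free degree `j k`, target `q s`, and `t` a repetition.
  let i : ℕ → ℕ := fun N => N.unpair.1.unpair.1
  obtain ⟨n, u, j, hj0, hB⟩ := exists_blocks hval hd fun N => q N.unpair.1.unpair.2
  have hj : StrictMono j := strictMono_nat_of_lt_succ fun N => (hB N).2.1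
  refine ⟨blockSubspace j i u, isClosed_blockSubspace j i u,
    not_finiteDimensional_blockSubspace hj0 hj fun N => (hB N).2.2.2.1, fun h hh => ?_⟩
  by_cases h0 : h = 0
  · exact Or.inr h0
  left
  obtain ⟨k, hk⟩ := exists_taylorCoeff_ne_zero hj0 hj hh h0
  have hlim : ∀ s, Tendsto (fun t => diffOp (P (n (Nat.pair (Nat.pair k s) t))) h) atTop
      (𝓝 (taylorCoeff (j k) h • q s)) := by
    intro s
    have hφ : Tendsto (fun t => Nat.pair (Nat.pair k s) t) atTop atTop :=
      tendsto_atTop_mono (fun t => Nat.right_le_pair _ t) tendsto_id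
    refine tendsto_of_forall_disc fun R hR ε hε => ?_
    have h1 : Tendsto (fun N => (∑' l, ‖taylorCoeff (l + j (N + 1)) h‖ *
        (2 * (R + 1)) ^ (l + j (N + 1))) + ‖taylorCoeff (j k) h‖ * (1 / ((N : ℝ) + 1)))
        atTop (𝓝 (0 + ‖taylorCoeff (j k) h‖ * 0)) :=
      ((tendsto_tail h _).comp (hj.tendsto_atTop.comp (tendsto_add_atTop_nat 1))).add
        (tendsto_one_div_add_atTop_nhds_zero_nat.const_mul _)
    rw [mul_zero, add_zero] at h1
    filter_upwards [hφ.eventually (h1.eventually_le_const hε),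
      hφ.eventually (eventually_ge_atTop ⌈R⌉₊)] with t ht htR z hz
    set N := Nat.pair (Nat.pair k s) t with hN
    have hiN : i N = k := by simp [i, hN]
    obtain ⟨hv, hjj, hsupp, -, hy, hC⟩ := hB N
    have e1 := norm_diffOp_sub_le hh hv hjj hsupp hC hz
    have e2 := hy z (hz.trans ((Nat.ceil_le.1 htR).trans (by linarith)))
    rw [hiN] at e1
    have hqN : q N.unpair.1.unpair.2 = q s := by simp [hN]
    rw [hqN] at e2
    refine le_trans ?_ ht
    have e3 : diffOp (P (n N)) h z - (taylorCoeff (j k) h • q s) z =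
        (diffOp (P (n N)) h - taylorCoeff (j k) h • diffOp (P (n N)) (ofPoly (u N))) z +
        taylorCoeff (j k) h * (diffOp (P (n N)) (ofPoly (u N)) - q s) z := by
      simp only [EntireSpace.sub_apply, EntireSpace.smul_apply]
      ring
    rw [e3]
    refine (norm_add_le _ _).trans (add_le_add e1 ?_)
    rw [norm_mul]
    gcongr
  have hdense : DenseRange fun s => taylorCoeff (j k) h • q s :=
    (Homeomorph.smulOfNeZero (taylorCoeff (j k) h) hk).surjective.denseRange.comp
      (TopologicalSpace.denseRange_denseSeq EntireSpace) (Homeomorph.continuous _)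
  have hsub : Set.range (fun s => taylorCoeff (j k) h • q s) ⊆
      closure (Set.range fun m => diffOp (P m) h) := by
    rintro _ ⟨s, rfl⟩
    exact mem_closure_of_tendsto (hlim s) (Eventually.of_forall fun t => ⟨_, rfl⟩)
  have : Dense (closure (Set.range fun m => diffOp (P m) h)) := hdense.mono hsub
  exact dense_closure.1 this

end Hypercyclicity

theorem theorem3p1 (P : ℕ → Polynomial ℂ)
    (hnonconst : ∀ n, 0 < (P n).natDegree)
    (hval : ¬ BddAbove (Set.range fun n => Hypercyclicity.valence (P n)))
    (hPQR : Hypercyclicity.PropertyP P ∨ Hypercyclicity.PropertyQ P ∨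
      Hypercyclicity.PropertyR P) :
    Hypercyclicity.Spaceable (Hypercyclicity.HC fun n => Hypercyclicity.diffOp (P n)) := by
  have hP : ∀ n, P n ≠ 0 := fun n h => by simpa [h] using hnonconst n
  let m : ℕ → ℕ := fun n => Hypercyclicity.valence (P n)
  have hfreq : ∀ K, ∃ᶠ n in atTop, K ≤ m n := by
    intro K hK
    obtain ⟨N, hN⟩ := eventually_atTop.1 hK
    refine hval ⟨max K ((Finset.range N).sup m), ?_⟩
    rintro _ ⟨n, rfl⟩
    rcases lt_or_ge n N with h | h
    · exact le_max_of_le_right (Finset.le_sup (f := m) (Finset.mem_range.2 h))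
    · exact le_max_of_le_left (not_le.1 (hN n h)).le
  -- `n → ∞` through indices whose valences tend to infinity; proper, as the valences are unbounded.
  let F : Filter ℕ := atTop ⊓ comap m atTop
  have hF : F ≤ atTop := inf_le_left
  have hFm : Tendsto m F atTop := tendsto_comap.mono_left inf_le_right
  have : F.NeBot := by
    refine (atTop_basis.inf (atTop_basis.comap m)).neBot_iff.2 ?_
    rintro ⟨N, K⟩ -
    obtain ⟨n, hn, hnN⟩ := ((hfreq K).and_eventually (eventually_ge_atTop N)).exists
    exact ⟨n, hnN, hn⟩
  refine Hypercyclicity.spaceable_HC_of_discDense (F := F) hFm ?_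
  rcases hPQR with h | h | h
  · exact h.discDense_smallPreimages hF
  · exact h.discDense_smallPreimages hP hF hFm
  · exact h.propertyP.discDense_smallPreimages hF
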